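/- Let $f:\mathbb{R}^n\to\mathbb{R}^n$ and $g:\mathbb{R}^n\to\mathbb{R}^{n\times m}$ be bounded and locally Lipschitz, let $U\subset\mathbb{R}^m$ be a nonempty polytope (the convex hull of finitely many points), and consider the control system $\dot{\mathrm x}=f(\mathrm x)+g(\mathrm x)\mathrm u$ with $\mathrm u(t)\in U$. Let $S=\{x : h(x)\ge 0\}\subseteq\mathbb{R}^n$, where $h:\mathbb{R}^n\to\mathbb{R}$ is continuously differentiable with $\nabla h(x)\neq 0$ for all $x\in\partial S$. Let $a:\mathbb{R}^n\to\mathbb{R}^m$ and $b:\mathbb{R}^n\to\mathbb{R}$ be locally Lipschitz, and put $K(x)=\{u\in U : a(x)^\top u\ge b(x)\}$. Suppose that * for every $x\in S$, $(a(x),b(x))\neq(0,0)$ and $K(x)$ has nonempty interior in $\mathbb{R}^m$; * for every $x\in\partial S$, $K(x)\subseteq\{u\in U : \nabla h(x)\cdot(f(x)+g(x)u)\ge 0\}$. Say that a feedback $\pi:\mathbb{R}^n\to\mathbb{R}^m$ *keeps trajectories from $S$ inside $X$* if for every $x_0\in S$ the closed-loop equation $\dot{\mathrm x}=f(\mathrm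 x)+g(\mathrm x)\pi(\mathrm x)$, $\mathrm x(0)=x_0$, has a solution on $[0,\infty)$, and every solution of it on any interval $[0,T]$ lies in $X$. Then: 1. $a$ and $b$ define a discriminating hyperplane for $S$. That is, $S$ is control invariant (from every $x_0\in S$ some measurable control signal $\mathrm u:[0,\infty)\to U$ has a solution with $\mathrm x(t)\in S$ for all $t\ge0$), and $a(x)^\top u\ge b(x)$ is a valid safety constraint with safe domain $S$: for every target set $X\supseteq S$ there is a locally Lipschitz feedback $\pi:\mathbb{R}^n\to U$ (globally Lipschitz if $S$ is compact) such that $a(x)^\top\pi(x)\ge b(x)$ for all $x\in S$ and $\pi$ keeps trajectories from $S$ inside $X$. 2. Every locally Lipschitz feedback $\pi:\mathbb{R}^n\to U$ with $a(x)^\top\pi(x)\ge b(x)$ for all $x\in S$ keeps trajectories from $S$ inside $S$. 3. For every locally Lipschitz reference controller $\pi_{\rm ref}:\mathbb{R}^n\to U$, the program $\min\{\|u-\pi_{\rm ref}(x)\|^2 : u\in U,\ a(x)^\top u\ge b(x)\}$ has exactly one solution at every $x\in S$; and every feedback $\pi_{\rm safe}$ that solves this program at each $x\in\mathbb{R}^n$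 at which it is feasible (a min-norm safety filter) keeps trajectories from $S$ inside $S$. -/

import Mathlib

open Set

noncomputable section

namespace SafetyFilter

/-- `ℝᵏ` with the Euclidean norm. -/
abbrev Vec (k : ℕ) : Type := EuclideanSpace ℝ (Fin k)

/-- A (nonempty) polytope: the convex hull of a nonempty finite set. -/
def IsPolytope {m : ℕ} (U : Set (Vec m)) : Prop :=
  ∃ V : Finset (Vec m), V.Nonempty ∧ U = convexHull ℝ (V : Set (Vec m))

/-- Standing assumptions on the control-affine system `ẋ = f(x) + g(x) u`, `u ∈ U`:
`f` and `g` are bounded and (locally) Lipschitz and `U` is compact. The matrix `g(x)` is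
given as a linear map `ℝᵐ → ℝⁿ`; boundedness and the Lipschitz property do not depend on
the choice of the matrix norm. -/
structure IsAdmissibleSystem {n m : ℕ} (f : Vec n → Vec n) (g : Vec n → (Vec m →L[ℝ] Vec n))
    (U : Set (Vec m)) : Prop where
  lipschitz_f : LocallyLipschitz f
  lipschitz_g : LocallyLipschitz g
  bounded_f : ∃ C : ℝ, ∀ x, ‖f x‖ ≤ C
  bounded_g : ∃ C : ℝ, ∀ x, ‖g x‖ ≤ C
  compact_U : IsCompact U

/-- `h` is a distance-like function of `S`: it is `C¹`, `S` is its zero-superlevel set, and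
its derivative does not vanish on the boundary of `S`. -/
structure IsDistanceLike {n : ℕ} (h : Vec n → ℝ) (S : Set (Vec n)) : Prop where
  contDiff : ContDiff ℝ 1 h
  eq_superlevel : S = {x | 0 ≤ h x}
  fderiv_ne_zero : ∀ x ∈ frontier S, fderiv ℝ h x ≠ 0

/-- The inputs `u ∈ U` that satisfy the half-space constraint `a(x)ᵀ u ≥ b(x)`. -/
def halfspaceInputs {n m : ℕ} (U : Set (Vec m)) (a : Vec n → Vec m) (b : Vec n → ℝ)
    (x : Vec n) : Set (Vec m) :=
  {u | u ∈ U ∧ b x ≤ inner ℝ (a x) u}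

/-- The inputs `u ∈ U` that satisfy the Nagumo-like condition `∂h/∂x (x) · (f(x) + g(x) u) ≥ 0`. -/
def nagumoInputs {n m : ℕ} (f : Vec n → Vec n) (g : Vec n → (Vec m →L[ℝ] Vec n))
    (U : Set (Vec m)) (h : Vec n → ℝ) (x : Vec n) : Set (Vec m) :=
  {u | u ∈ U ∧ 0 ≤ fderiv ℝ h x (f x + g x u)}

/-- `S` is control invariant: from every initial state in `S` some measurable control signal
with values in `U` has a (Carathéodory) solution that stays in `S` for all `t ≥ 0`. -/
def IsControlInvariant {n m : ℕ} (f : Vec n → Vec n) (g : Vec n → (Vec m →L[ℝ] Vec n))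
    (U : Set (Vec m)) (S : Set (Vec n)) : Prop :=
  ∀ x₀ ∈ S, ∃ (u : ℝ → Vec m) (x : ℝ → Vec n),
    Measurable u ∧ (∀ t, 0 ≤ t → u t ∈ U) ∧ ContinuousOn x (Ici 0) ∧
    (∀ t, 0 ≤ t →
      IntervalIntegrable (fun s => f (x s) + g (x s) (u s)) MeasureTheory.volume 0 t ∧
      x t = x₀ + ∫ s in (0 : ℝ)..t, (f (x s) + g (x s) (u s))) ∧
    ∀ t, 0 ≤ t → x t ∈ S

/-- `x` solves the closed-loop equation `ẋ = f(x) + g(x) π(x)` on the time interval `I`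
(one-sided derivatives at end points of `I`). -/
def IsClosedLoopTrajectory {n m : ℕ} (f : Vec n → Vec n) (g : Vec n → (Vec m →L[ℝ] Vec n))
    (π : Vec n → Vec m) (I : Set ℝ) (x : ℝ → Vec n) : Prop :=
  ∀ t ∈ I, HasDerivWithinAt x (f (x t) + g (x t) (π (x t))) I t

/-- The feedback `π` keeps trajectories from `S` inside `X`: from every initial state in `S`
there is a closed-loop trajectory on `[0, ∞)`, and every closed-loop trajectory, on
whatever interval `[0, T]` it is defined, lies in `X`. -/
def KeepsInside {n m : ℕ} (f : Vec n → Vec n) (g : Vec n → (Vec m →L[ℝ] Vec n))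
    (π : Vec n → Vec m) (S X : Set (Vec n)) : Prop :=
  ∀ x₀ ∈ S,
    (∃ x : ℝ → Vec n, x 0 = x₀ ∧ IsClosedLoopTrajectory f g π (Ici 0) x) ∧
    ∀ (T : ℝ) (x : ℝ → Vec n), x 0 = x₀ → IsClosedLoopTrajectory f g π (Icc 0 T) x →
      ∀ t ∈ Icc 0 T, x t ∈ X

/-- `c(x, u) ≥ 0` is a valid safety constraint with safe domain `S`, for the target
constraint set `X`. The feedback is locally Lipschitz, and globally Lipschitz if the safe
domain is compact. -/
def IsSafetyConstraint {n m : ℕ} (f : Vec n → Vec n) (g : Vec n → (Vec m →L[ℝ] Vec n))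
    (U : Set (Vec m)) (X S : Set (Vec n)) (c : Vec n → Vec m → ℝ) : Prop :=
  S ⊆ X ∧ ∃ π : Vec n → Vec m,
    LocallyLipschitz π ∧ (IsCompact S → ∃ L, LipschitzWith L π) ∧
    (∀ x, π x ∈ U) ∧ (∀ x ∈ S, 0 ≤ c x (π x)) ∧ KeepsInside f g π S X

/-- `a(x)ᵀ u = b(x)` is a discriminating hyperplane for the control invariant set `S`: the
half-space constraint `a(x)ᵀ u - b(x) ≥ 0` is a safety constraint with safe domain `S`, for
every target constraint set `X` that contains `S`. -/
def IsDiscriminatingHyperplane {n m : ℕ} (f : Vec n → Vec n) (g : Vec n → (Vec m →L[ℝ] Vec n))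
    (U : Set (Vec m)) (S : Set (Vec n)) (a : Vec n → Vec m) (b : Vec n → ℝ) : Prop :=
  IsControlInvariant f g U S ∧
    ∀ X : Set (Vec n), S ⊆ X →
      IsSafetyConstraint f g U X S (fun x u => inner ℝ (a x) u - b x)

/-- `u` solves the program: minimize `‖u - r‖²` over `u ∈ U` with `a(x)ᵀ u ≥ b(x)`. -/
def IsMinNormInput {n m : ℕ} (U : Set (Vec m)) (a : Vec n → Vec m) (b : Vec n → ℝ)
    (r : Vec m) (x : Vec n) (u : Vec m) : Prop :=
  u ∈ halfspaceInputs U a b x ∧ IsMinOn (fun v => ‖v - r‖ ^ 2) (halfspaceInputs U a b x) u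

/-- `πsafe` is the min-norm safety filter for the reference controller `πref`: it solves the
program at every state, inside or outside `S`, at which the program is feasible. -/
def IsMinNormFilter {n m : ℕ} (U : Set (Vec m)) (a : Vec n → Vec m) (b : Vec n → ℝ)
    (πref πsafe : Vec n → Vec m) : Prop :=
  ∀ x, (halfspaceInputs U a b x).Nonempty → IsMinNormInput U a b (πref x) x (πsafe x)

end SafetyFilter

end

/-! Nagumo's theorem needs less than a Lipschitz vector field. Suppose that near the boundary of `S`
the closed-loop field at `x` is within `L * ‖x - y‖` of an inward-pointing vector at `y`, for every
boundary point `y`. Taking `y` nearest to `x`, the distance from a trajectory to `S` grows at rate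
at most `L` times itself, and Grönwall keeps it zero. This is `mem_superlevel_of_hasDerivWithinAt`;
uniqueness of solutions plays no role.

A locally Lipschitz feedback meets the condition at once: compare `π x` with `π y`. A min-norm
filter is only shown to be continuous, but its value is feasible at `x`, and the feasible set itself
moves in a Lipschitz way (`exists_halfspaceInputs_norm_sub_le`), so some feasible input at `y` is
close to it. The Lipschitz bound comes from strict feasibility, which follows from nonempty interior
and `(a, b) ≠ (0, 0)`. Continuity of the filter gives existence of trajectories through Peano's
theorem.

Strict feasibility also makes constant inputs locally admissible; a smooth partition of unity glues
them into the feedback required by the discriminating hyperplane. -/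

/-! ### Existence of solutions -/

open Filter Topology Metric in
/-- A bounded `C¹` vector field has solutions on every interval `[0, T]`. -/
theorem ContDiff.exists_hasDerivWithinAt_Icc {E : Type*} [NormedAddCommGroup E] [NormedSpace ℝ E]
    [FiniteDimensional ℝ E] {G : E → E} (hG : ContDiff ℝ 1 G) {M : ℝ} (hM : ∀ x, ‖G x‖ ≤ M)
    (x₀ : E) {T : ℝ} (hT : 0 ≤ T) :
    ∃ x : ℝ → E, x 0 = x₀ ∧ ∀ t ∈ Icc 0 T, HasDerivWithinAt x (G (x t)) (Icc 0 T) t := by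
  have : ProperSpace E := FiniteDimensional.proper ℝ E
  have hM0 : 0 ≤ M := (norm_nonneg _).trans (hM x₀)
  obtain ⟨K, hK⟩ := (hG.locallyLipschitz.locallyLipschitzOn
    (s := closedBall x₀ (M * T))).exists_lipschitzOnWith_of_compact (isCompact_closedBall _ _)
  have hpl : IsPicardLindelof (fun _ => G) (tmin := 0) (tmax := T) ⟨0, le_rfl, hT⟩ x₀
      ⟨M * T, by positivity⟩ 0 ⟨M, hM0⟩ K :=
    IsPicardLindelof.of_time_independent (fun x _ => hM x) hK (by
      change M * max (T - 0) (0 - 0) ≤ M * T - 0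
      simp [hT])
  exact hpl.exists_eq_forall_mem_Icc_hasDerivWithinAt₀

open Filter Topology Metric in
/-- **Peano existence theorem**, for bounded continuous vector fields on a finite-dimensional
space. -/
theorem Continuous.exists_hasDerivWithinAt_Ici {E : Type*} [NormedAddCommGroup E]
    [NormedSpace ℝ E] [FiniteDimensional ℝ E] {F : E → E} (hF : Continuous F) {M : ℝ}
    (hM : ∀ x, ‖F x‖ ≤ M) (x₀ : E) :
    ∃ x : ℝ → E, x 0 = x₀ ∧ ∀ t ∈ Ici (0 : ℝ), HasDerivWithinAt x (F (x t)) (Ici 0) t := by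
  have : ProperSpace E := FiniteDimensional.proper ℝ E
  have hM0 : 0 ≤ M := (norm_nonneg _).trans (hM x₀)
  have happrox : ∀ k : ℕ, ∃ G : E → E, ContDiff ℝ 1 G ∧ ∀ x, dist (G x) (F x) < 1 / ((k : ℝ) + 1) :=
    fun k => by
      obtain ⟨G, hG, hGF, -⟩ := hF.exists_contDiff_approx 1 (ε := fun _ => 1 / ((k : ℝ) + 1))
        continuous_const (fun _ => by positivity)
      exact ⟨G, hG, hGF⟩
  choose G hG hGF using happrox
  have hGM : ∀ k x, ‖G k x‖ ≤ M + 1 := fun k x => by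
    have h1 := (hGF k x).le
    have h2 : 1 / ((k : ℝ) + 1) ≤ 1 := by
      rw [div_le_one (by positivity)]; linarith [k.cast_nonneg (α := ℝ)]
    rw [dist_eq_norm] at h1
    have h3 := norm_le_norm_add_norm_sub' (G k x) (F x)
    have h4 := hM x
    linarith
  choose y hy0 hy using fun k : ℕ =>
    (hG k).exists_hasDerivWithinAt_Icc (hGM k) x₀ (k.cast_nonneg (α := ℝ))
  have hlip : ∀ (k : ℕ), ∀ s ∈ Icc (0 : ℝ) k, ∀ t ∈ Icc (0 : ℝ) k,
      ‖y k t - y k s‖ ≤ (M + 1) * ‖t - s‖ := fun k s hs t ht =>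
    (convex_Icc (0 : ℝ) k).norm_image_sub_le_of_norm_hasDerivWithin_le (hy k)
      (fun τ _ => hGM k _) hs ht
  -- An ultrafilter replaces Arzelà–Ascoli and diagonal subsequences: bounded values converge along
  -- it at every time simultaneously. The common Lipschitz constant `M + 1` makes pointwise limits
  -- sufficient.
  let 𝒰 : Ultrafilter ℕ := hyperfilter ℕ
  have h𝒰 : (𝒰 : Filter ℕ) ≤ atTop := Nat.hyperfilter_le_atTop
  have hge : ∀ c : ℝ, ∀ᶠ k : ℕ in 𝒰, c ≤ k := fun c =>
    h𝒰 (tendsto_natCast_atTop_atTop.eventually_ge_atTop c)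
  have hlim : ∀ t : ℝ, ∃ p : E, 0 ≤ t → Tendsto (fun k => y k t) 𝒰 (𝓝 p) := by
    intro t
    by_cases ht : 0 ≤ t
    · have hmem : ∀ᶠ k in 𝒰, y k t ∈ closedBall x₀ ((M + 1) * t) := by
        filter_upwards [hge t] with k hk
        have := hlip k 0 ⟨le_rfl, k.cast_nonneg⟩ t ⟨ht, hk⟩
        rw [hy0, sub_zero, Real.norm_of_nonneg ht] at this
        rwa [mem_closedBall, dist_eq_norm]
      obtain ⟨p, -, hp⟩ := (isCompact_closedBall x₀ ((M + 1) * t)).ultrafilter_le_nhds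
        (𝒰.map fun k => y k t) (le_principal_iff.2 hmem)
      exact ⟨p, fun _ => hp⟩
    · exact ⟨0, fun h => absurd h ht⟩
  choose x hx using hlim
  refine ⟨x, tendsto_nhds_unique (hx 0 le_rfl) (by simp [hy0]), fun t ht => ?_⟩
  rw [hasDerivWithinAt_iff_isLittleO, Asymptotics.isLittleO_iff]
  intro ε hε
  obtain ⟨δ, hδ, hFδ⟩ := Metric.continuous_iff.1 hF (x t) (ε / 2) (by positivity)
  -- Within this time an approximate solution moves less than `δ / 2`. Starting within `δ / 2` of `x
  -- t`, it stays where `F` varies by less than `ε / 2`; the other `ε / 2` pays for replacing `F` by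
  -- `G k`.
  have hη : 0 < δ / (2 * (M + 1)) := by positivity
  filter_upwards [self_mem_nhdsWithin, nhdsWithin_le_nhds (ball_mem_nhds t hη)] with s hs hst
  have hlimst : Tendsto (fun k => ‖y k s - y k t - (s - t) • F (x t)‖) 𝒰
      (𝓝 ‖x s - x t - (s - t) • F (x t)‖) :=
    (((hx s hs).sub (hx t ht)).sub_const _).norm
  refine le_of_tendsto hlimst ?_
  filter_upwards [hge (max s t), (hx t ht).eventually (ball_mem_nhds (x t) (half_pos hδ)),
    h𝒰 ((tendsto_one_div_add_atTop_nhds_zero_nat (𝕜 := ℝ)).eventually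
      (gt_mem_nhds (half_pos hε)))] with k hk hkt hkε
  have hsub : uIcc t s ⊆ Icc (0 : ℝ) k := fun τ hτ =>
    ⟨(le_min ht hs).trans hτ.1, hτ.2.trans (by rwa [max_comm])⟩
  have key := (convex_uIcc t s).norm_image_sub_le_of_norm_hasDerivWithin_le
    (f := fun τ => y k τ - τ • F (x t)) (f' := fun τ => G k (y k τ) - F (x t)) (C := ε)
    (fun τ hτ => ((hy k τ (hsub hτ)).mono hsub).sub
      (by simpa using (hasDerivWithinAt_id τ (uIcc t s)).smul_const (F (x t)))) ?_
    left_mem_uIcc right_mem_uIcc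
  · have e : y k s - y k t - (s - t) • F (x t) =
        y k s - s • F (x t) - (y k t - t • F (x t)) := by rw [sub_smul]; abel
    rw [e]; exact key
  · intro τ hτ
    have h1 := hlip k t (hsub left_mem_uIcc) τ (hsub hτ)
    have h2 : ‖τ - t‖ < δ / (2 * (M + 1)) :=
      (abs_sub_left_of_mem_uIcc hτ).trans_lt (by simpa [Real.dist_eq] using hst)
    have h3 : (M + 1) * ‖τ - t‖ < δ / 2 := by
      rw [lt_div_iff₀ (by positivity)] at h2; linarith
    have h4 : dist (y k τ) (x t) < δ := by
      have := dist_triangle (y k τ) (y k t) (x t)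
      rw [dist_eq_norm (y k τ) (y k t)] at this
      have h5 : dist (y k t) (x t) < δ / 2 := hkt
      linarith
    have h5 := hFδ _ h4
    have h6 := hGF k (y k τ)
    rw [← dist_eq_norm]
    linarith [dist_triangle (G k (y k τ)) (F (y k τ)) (F (x t))]

/-! ### Nagumo's theorem -/

open Filter Topology Metric in
/-- A point of `S` that is closest to a point outside the interior of `S` lies on the boundary. -/
theorem mem_frontier_of_infDist_eq_dist {E : Type*} [NormedAddCommGroup E] [NormedSpace ℝ E]
    {S : Set E} {x y : E} (hx : x ∉ interior S) (hy : y ∈ S) (hxy : infDist x S = dist x y) :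
    y ∈ frontier S := by
  refine ⟨subset_closure hy, fun hyi => ?_⟩
  have hne : 0 < dist x y := dist_pos.2 fun h => hx (h ▸ hyi)
  -- From an interior point of `S`, a small step towards `x` would stay in `S` and be strictly
  -- closer to `x`.
  have hcont : Tendsto (fun θ : ℝ => AffineMap.lineMap y x θ) (𝓝[>] 0) (𝓝 y) := by
    have : Continuous fun θ : ℝ => AffineMap.lineMap (k := ℝ) y x θ := AffineMap.lineMap_continuous
    exact (this.tendsto' 0 y (by simp)).mono_left nhdsWithin_le_nhds
  obtain ⟨θ, hθS, hθ1, hθ0⟩ := ((hcont.eventually (mem_interior_iff_mem_nhds.1 hyi)).and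
    ((eventually_nhdsWithin_of_eventually_nhds (gt_mem_nhds (zero_lt_one' ℝ))).and
      eventually_mem_nhdsWithin)).exists
  have hle : infDist x S ≤ dist x (AffineMap.lineMap y x θ) := infDist_le_dist_of_mem hθS
  rw [hxy, dist_comm x (AffineMap.lineMap y x θ), dist_lineMap_right, dist_comm y x,
    Real.norm_of_nonneg (sub_nonneg.2 hθ1.le)] at hle
  have : 0 < θ := hθ0
  nlinarith

open Filter Topology Metric in
/-- A superlevel set is entered along every direction in which the function increases strictly. -/
theorem eventually_nonneg_add_smul_of_fderiv_pos {E : Type*} [NormedAddCommGroup E]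
    [NormedSpace ℝ E] {h : E → ℝ} {y v : E} (hd : DifferentiableAt ℝ h y) (hy : 0 ≤ h y)
    (hv : 0 < fderiv ℝ h y v) : ∀ᶠ s in 𝓝[>] (0 : ℝ), 0 ≤ h (y + s • v) := by
  have hline : HasDerivAt (fun s : ℝ => y + s • v) v 0 := by
    simpa using ((hasDerivAt_id (0 : ℝ)).smul_const v).const_add y
  have hd' : HasFDerivAt h (fderiv ℝ h y) (y + (0 : ℝ) • v) := by simpa using hd.hasFDerivAt
  have hslope := (hd'.comp_hasDerivAt (0 : ℝ) hline).hasDerivWithinAt (s := Ioi 0)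
  rw [hasDerivWithinAt_iff_tendsto_slope' (by simp)] at hslope
  filter_upwards [hslope.eventually (lt_mem_nhds hv), self_mem_nhdsWithin] with s hs hs0
  have hs0' : (0 : ℝ) < s := hs0
  rw [slope_def_field, sub_zero, div_pos_iff_of_pos_right hs0'] at hs
  simp only [Function.comp_apply, zero_smul, add_zero] at hs
  linarith

open Filter Topology Metric in
/-- **Nagumo's theorem** for a superlevel set `S` of `h`, for a vector field which near the boundary
of `S` is Lipschitz-close to inward-pointing vectors. -/
theorem mem_superlevel_of_hasDerivWithinAt {E : Type*} [NormedAddCommGroup E] [NormedSpace ℝ E]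
    [FiniteDimensional ℝ E] {h : E → ℝ} {S : Set E} {F : E → E} (hd : Differentiable ℝ h)
    (hS : S = {x | 0 ≤ h x}) (hne : ∀ x ∈ frontier S, fderiv ℝ h x ≠ 0)
    (hF : ∀ p ∈ frontier S, ∃ V ∈ 𝓝 p, ∃ L : ℝ, ∀ x ∈ V, ∀ y ∈ V, y ∈ frontier S →
      ∃ w, 0 ≤ fderiv ℝ h y w ∧ ‖F x - w‖ ≤ L * ‖x - y‖)
    {T : ℝ} {x : ℝ → E} (hx0 : x 0 ∈ S)
    (hx : ∀ t ∈ Icc 0 T, HasDerivWithinAt x (F (x t)) (Icc 0 T) t) :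
    ∀ t ∈ Icc 0 T, x t ∈ S := by
  have : ProperSpace E := FiniteDimensional.proper ℝ E
  have hcl : IsClosed S := hS ▸ isClosed_le continuous_const hd.continuous
  have hxc : ContinuousOn x (Icc 0 T) := fun t ht => (hx t ht).continuousWithinAt
  intro t₁ ht₁
  by_contra hxt₁
  have hsub : ∀ {u}, u ≤ t₁ → Icc 0 u ⊆ Icc 0 T := fun hu =>
    Icc_subset_Icc_right (hu.trans ht₁.2)
  -- the last time before `t₁` at which the trajectory is in `S`
  have hAcl : IsClosed (Icc 0 t₁ ∩ x ⁻¹' S) :=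
    (hxc.mono (hsub le_rfl)).preimage_isClosed_of_isClosed isClosed_Icc hcl
  have hAc : IsCompact (Icc 0 t₁ ∩ x ⁻¹' S) := isCompact_Icc.of_isClosed_subset hAcl inter_subset_left
  obtain ⟨t₀, ⟨ht₀, hxt₀⟩, hmax⟩ := hAc.exists_isGreatest ⟨0, ⟨le_rfl, ht₁.1⟩, hx0⟩
  have hout : ∀ t ∈ Ioc t₀ t₁, x t ∉ S := fun t ht htS =>
    (hmax ⟨⟨ht₀.1.trans ht.1.le, ht.2⟩, htS⟩).not_gt ht.1
  have hlt : t₀ < t₁ := ht₀.2.lt_of_ne fun h => hxt₁ (h ▸ hxt₀)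
  have hsub' : Icc t₀ t₁ ⊆ Icc 0 T := Icc_subset_Icc ht₀.1 ht₁.2
  have hxc' : ContinuousOn x (Icc t₀ t₁) := hxc.mono hsub'
  have hgt : Tendsto x (𝓝[>] t₀) (𝓝 (x t₀)) := by
    rw [← nhdsWithin_Ioc_eq_nhdsGT hlt]
    exact (hxc' t₀ ⟨le_rfl, hlt.le⟩).mono Ioc_subset_Icc_self
  have hni : ∀ t ∈ Icc t₀ t₁, x t ∉ interior S := by
    intro t ht hti
    rcases ht.1.eq_or_lt with rfl | htlt
    · obtain ⟨s, hs, hs'⟩ := ((hgt.eventually (mem_interior_iff_mem_nhds.1 hti)).and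
        (Ioc_mem_nhdsGT hlt)).exists
      exact hout s hs' hs
    · exact hout t ⟨htlt, ht.2⟩ (interior_subset hti)
  have hfr : x t₀ ∈ frontier S := ⟨subset_closure hxt₀, hni t₀ ⟨le_rfl, hlt.le⟩⟩
  obtain ⟨V, hV, L, hL⟩ := hF _ hfr
  obtain ⟨ρ, hρ, hρV⟩ := Metric.mem_nhds_iff.1 hV
  -- Half the radius, because a nearest point of `S` to `x t` can be twice as far from `x t₀` as `x
  -- t` is.
  obtain ⟨t₂, ht₂, hball⟩ : ∃ t₂ ∈ Ioc t₀ t₁, ∀ t ∈ Icc t₀ t₂, x t ∈ ball (x t₀) (ρ / 2) := by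
    obtain ⟨u, hu, hu'⟩ := mem_nhdsGT_iff_exists_Ioc_subset.1
      (hgt (ball_mem_nhds (x t₀) (half_pos hρ)))
    have hu0 : t₀ < u := hu
    refine ⟨min u t₁, ⟨lt_min hu0 hlt, min_le_right _ _⟩, fun t ht => ?_⟩
    rcases ht.1.eq_or_lt with rfl | htlt
    · exact mem_ball_self (half_pos hρ)
    · exact hu' ⟨htlt, ht.2.trans (min_le_left _ _)⟩
  have hdist : ContinuousOn (fun t => infDist (x t) S) (Icc t₀ t₂) :=
    (continuous_infDist_pt S).comp_continuousOn (hxc'.mono (Icc_subset_Icc_right ht₂.2))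
  -- The distance to `S` need not be differentiable; a bound on its lower right Dini derivative is
  -- enough. With zero initial value and zero forcing the Grönwall bound vanishes, contradicting `x
  -- t₂ ∉ S`.
  have hbound := le_gronwallBound_of_liminf_deriv_right_le (f := fun t => infDist (x t) S)
    (f' := fun t => L * infDist (x t) S) (δ := 0) (K := L) (ε := 0) hdist ?_
    (infDist_zero_of_mem (s := S) hxt₀).le (fun t _ => by simp) t₂ ⟨ht₂.1.le, le_rfl⟩
  · rw [gronwallBound_ε0_δ0] at hbound
    exact hout t₂ ht₂ ((hcl.mem_iff_infDist_zero ⟨_, hxt₀⟩).2 (hbound.antisymm infDist_nonneg))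
  intro t ht r hr
  have htI : t ∈ Icc t₀ t₁ := ⟨ht.1, ht.2.le.trans ht₂.2⟩
  obtain ⟨y, hyS, hy⟩ := hcl.exists_infDist_eq_dist ⟨_, hxt₀⟩ (x t)
  have hyfr : y ∈ frontier S := mem_frontier_of_infDist_eq_dist (hni t htI) hyS hy
  have hxb := mem_ball.1 (hball t ⟨ht.1, ht.2.le⟩)
  have hyV : y ∈ V := hρV <| by
    have h1 : dist (x t) y ≤ dist (x t) (x t₀) := hy ▸ infDist_le_dist_of_mem hxt₀
    have h2 := dist_triangle_left y (x t₀) (x t)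
    rw [mem_ball]
    linarith
  obtain ⟨w, hw, hFw⟩ := hL (x t) (hρV (mem_ball.2 (hxb.trans (half_lt_self hρ)))) y hyV hyfr
  rw [← dist_eq_norm (x t) y, ← hy] at hFw
  -- Since `w` may be tangent to the boundary, it is tilted by `ε • n` into a strictly inward
  -- direction. The margin `ε * (‖n‖ + 1)` covers the tilt and the first-order error of the
  -- trajectory.
  obtain ⟨n, hn⟩ : ∃ n, 0 < fderiv ℝ h y n := by
    obtain ⟨n, hn⟩ := DFunLike.ne_iff.1 (hne y hyfr)
    rcases lt_or_gt_of_ne hn with hn | hn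
    · exact ⟨-n, by simpa using hn⟩
    · exact ⟨n, hn⟩
  have hr' : L * infDist (x t) S < r := hr
  obtain ⟨ε, hε, hεr⟩ : ∃ ε > 0, ε * (‖n‖ + 1) < r - L * infDist (x t) S :=
    ⟨(r - L * infDist (x t) S) / (2 * (‖n‖ + 1)), by have := sub_pos.2 hr'; positivity, by
      have h1 : 0 < ‖n‖ + 1 := by positivity
      field_simp
      linarith⟩
  have hv : 0 < fderiv ℝ h y (w + ε • n) := by
    simp only [map_add, map_smul, smul_eq_mul]; positivity
  have hyh : 0 ≤ h y := by rw [hS] at hyS; exact hyS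
  have hin : ∀ᶠ z in 𝓝[>] t, 0 ≤ h (y + (z - t) • (w + ε • n)) := by
    have hsh : Tendsto (fun z : ℝ => z - t) (𝓝[>] t) (𝓝[>] 0) := by
      refine tendsto_nhdsWithin_iff.2 ⟨?_, ?_⟩
      · exact ((continuous_sub_right t).tendsto' t 0 (sub_self t)).mono_left nhdsWithin_le_nhds
      · filter_upwards [self_mem_nhdsWithin] with z hz using sub_pos.2 (mem_Ioi.1 hz)
    exact hsh.eventually (eventually_nonneg_add_smul_of_fderiv_pos (hd y) hyh hv)
  have htT : t < T := ht.2.trans_le (ht₂.2.trans ht₁.2)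
  have hder : HasDerivWithinAt x (F (x t)) (Ioi t) t :=
    (hx t (hsub' htI)).mono_of_mem_nhdsWithin
      (mem_of_superset (Ioc_mem_nhdsGT htT) fun s hs =>
        ⟨(hsub' htI).1.trans hs.1.le, hs.2⟩)
  rw [hasDerivWithinAt_iff_isLittleO] at hder
  refine Eventually.frequently ?_
  filter_upwards [hin, hder.def hε, self_mem_nhdsWithin] with z hz hzx hzt
  have hzt' : 0 < z - t := sub_pos.2 hzt
  have hzS : y + (z - t) • (w + ε • n) ∈ S := by rw [hS]; exact hz
  have h1 : infDist (x z) S ≤ ‖x z - (y + (z - t) • (w + ε • n))‖ := by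
    rw [← dist_eq_norm]; exact infDist_le_dist_of_mem hzS
  have h2 : x z - (y + (z - t) • (w + ε • n)) = (x z - x t - (z - t) • F (x t)) + (x t - y) +
      (z - t) • (F (x t) - w - ε • n) := by
    simp only [smul_add, smul_sub]; abel
  have h3 : ‖F (x t) - w - ε • n‖ ≤ L * infDist (x t) S + ε * ‖n‖ :=
    (norm_sub_le _ _).trans (by rw [norm_smul, Real.norm_of_nonneg hε.le]; gcongr)
  have h4 : ‖(z - t) • (F (x t) - w - ε • n)‖ ≤ (z - t) * (L * infDist (x t) S + ε * ‖n‖) := by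
    rw [norm_smul, Real.norm_of_nonneg hzt'.le]; gcongr
  rw [Real.norm_of_nonneg hzt'.le] at hzx
  have h5 : ‖x t - y‖ = infDist (x t) S := by rw [hy, dist_eq_norm]
  have h6 : infDist (x z) S ≤ ε * (z - t) + infDist (x t) S +
      (z - t) * (L * infDist (x t) S + ε * ‖n‖) := by
    refine h1.trans (h2 ▸ (norm_add₃_le).trans ?_)
    rw [h5]; gcongr
  rw [inv_mul_lt_iff₀ hzt']
  nlinarith [mul_lt_mul_of_pos_left hεr hzt']

/-! ### Cutoff and local Lipschitz estimates -/

open Topology in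
/-- A bounded function that is continuous on a neighbourhood of a closed set `S` agrees near `S`
with a bounded continuous function. -/
theorem ContinuousOn.exists_continuous_bounded_eqOn {X E : Type*} [TopologicalSpace X]
    [NormalSpace X] [NormedAddCommGroup E] [NormedSpace ℝ E] {F : X → E} {S N : Set X} {M : ℝ}
    (hS : IsClosed S) (hN : IsOpen N) (hSN : S ⊆ N) (hF : ContinuousOn F N)
    (hM : ∀ x ∈ N, ‖F x‖ ≤ M) :
    ∃ G : X → E, Continuous G ∧ (∀ x, ‖G x‖ ≤ |M|) ∧ ∃ V, IsOpen V ∧ S ⊆ V ∧ EqOn G F V := by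
  obtain ⟨V, hV, hSV, hVN⟩ := normal_exists_closure_subset hS hN hSN
  -- The second layer makes the cutoff vanish on a neighbourhood of each point outside `N`, where
  -- nothing is known about `F`. The bound is `|M|` because `M` may be negative when `N` is empty.
  obtain ⟨W, hW, hVW, hWN⟩ := normal_exists_closure_subset isClosed_closure hN hVN
  obtain ⟨χ, hχ0, hχ1, hχ⟩ := exists_continuous_zero_one_of_isClosed hW.isClosed_compl
    isClosed_closure (disjoint_compl_left_iff_subset.2 hVW)
  refine ⟨fun x => χ x • F x, continuous_iff_continuousAt.2 fun x => ?_, fun x => ?_,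
    V, hV, hSV, fun x hx => ?_⟩
  · by_cases hx : x ∈ N
    · exact χ.continuous.continuousAt.smul (hF.continuousAt (hN.mem_nhds hx))
    · have : (fun x => χ x • F x) =ᶠ[𝓝 x] fun _ => 0 := by
        filter_upwards [isClosed_closure.isOpen_compl.mem_nhds fun h => hx (hWN h)] with y hy
        rw [hχ0 fun h => hy (subset_closure h), Pi.zero_apply, zero_smul]
      exact continuousAt_const.congr this.symm
  · rw [norm_smul, Real.norm_of_nonneg (hχ x).1]
    by_cases hx : x ∈ N
    · exact (mul_le_of_le_one_left (norm_nonneg _) (hχ x).2).trans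
        ((hM x hx).trans (le_abs_self M))
    · rw [hχ0 fun h => hx (hWN (subset_closure h))]
      simp
  · simp [hχ1 (subset_closure hx)]

/-- Near any point, a locally Lipschitz function satisfies a norm estimate with a nonnegative real
constant. -/
theorem LocallyLipschitz.exists_norm_sub_le {E E' : Type*} [NormedAddCommGroup E]
    [NormedAddCommGroup E'] {φ : E → E'} (hφ : LocallyLipschitz φ) (p : E) :
    ∃ L : ℝ, 0 ≤ L ∧ ∃ V ∈ nhds p, ∀ x ∈ V, ∀ y ∈ V, ‖φ x - φ y‖ ≤ L * ‖x - y‖ := by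
  obtain ⟨K, V, hV, hK⟩ := hφ p
  exact ⟨K, K.2, V, hV, fun x hx y hy => hK.norm_sub_le hx hy⟩

/-! ### From feedbacks to invariance -/

namespace SafetyFilter

variable {n m : ℕ} {f : Vec n → Vec n} {g : Vec n → (Vec m →L[ℝ] Vec n)} {U : Set (Vec m)}
  {S : Set (Vec n)} {h : Vec n → ℝ} {a : Vec n → Vec m} {b : Vec n → ℝ} {π : Vec n → Vec m}

open Topology in
/-- A feedback that is continuous near `S` and, near the boundary of `S`, Lipschitz-close to inputs
satisfying the half-space constraint keeps trajectories from `S` inside `S`. -/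
theorem keepsInside_of_lipschitz_close (hsys : IsAdmissibleSystem f g U) (hh : IsDistanceLike h S)
    (hsub : ∀ x ∈ frontier S, halfspaceInputs U a b x ⊆ nagumoInputs f g U h x)
    {N : Set (Vec n)} (hN : IsOpen N) (hSN : S ⊆ N) (hπc : ContinuousOn π N)
    (hπU : ∀ x ∈ N, π x ∈ U)
    (hπ : ∀ p ∈ frontier S, ∃ V ∈ 𝓝 p, ∃ L : ℝ, ∀ x ∈ V, ∀ y ∈ V, y ∈ frontier S →
      ∃ u ∈ halfspaceInputs U a b y, ‖π x - u‖ ≤ L * ‖x - y‖) :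
    KeepsInside f g π S S := by
  obtain ⟨Cf, hCf⟩ := hsys.bounded_f
  obtain ⟨Cg, hCg⟩ := hsys.bounded_g
  obtain ⟨R, hR⟩ := hsys.compact_U.isBounded.exists_norm_le
  have hd : Differentiable ℝ h := hh.contDiff.differentiable one_ne_zero
  have hcl : IsClosed S := hh.eq_superlevel ▸ isClosed_le continuous_const hd.continuous
  set F : Vec n → Vec n := fun x => f x + g x (π x) with hFdef
  have hFS : ∀ p ∈ frontier S, ∃ V ∈ 𝓝 p, ∃ L : ℝ, ∀ x ∈ V, ∀ y ∈ V, y ∈ frontier S →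
      ∃ w, 0 ≤ fderiv ℝ h y w ∧ ‖F x - w‖ ≤ L * ‖x - y‖ := by
    intro p hp
    obtain ⟨V₁, hV₁, L₁, hL₁⟩ := hπ p hp
    obtain ⟨L₂, -, V₂, hV₂, hL₂⟩ := hsys.lipschitz_f.exists_norm_sub_le p
    obtain ⟨L₃, hL₃0, V₃, hV₃, hL₃⟩ := hsys.lipschitz_g.exists_norm_sub_le p
    refine ⟨V₁ ∩ (V₂ ∩ V₃), Filter.inter_mem hV₁ (Filter.inter_mem hV₂ hV₃),
      L₂ + Cg * L₁ + L₃ * R, ?_⟩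
    rintro x ⟨hx₁, hx₂, hx₃⟩ y ⟨hy₁, hy₂, hy₃⟩ hy
    obtain ⟨u, hu, hπu⟩ := hL₁ x hx₁ y hy₁ hy
    refine ⟨f y + g y u, (hsub y hy hu).2, ?_⟩
    have e : F x - (f y + g y u) = (f x - f y) + g x (π x - u) + (g x - g y) u := by
      simp only [hFdef, map_sub, sub_apply]; abel
    have h1 : ‖g x (π x - u)‖ ≤ Cg * (L₁ * ‖x - y‖) :=
      (g x).le_of_opNorm_le_of_le (hCg x) hπu
    have h2 : ‖(g x - g y) u‖ ≤ L₃ * ‖x - y‖ * R :=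
      (g x - g y).le_of_opNorm_le_of_le (hL₃ x hx₃ y hy₃) (hR u hu.1)
    have h3 := hL₂ x hx₂ y hy₂
    have h4 := e ▸ (norm_add₃_le (a := f x - f y) (b := g x (π x - u)) (c := (g x - g y) u))
    linarith
  have hFc : ContinuousOn F N := hsys.lipschitz_f.continuous.continuousOn.add
    (hsys.lipschitz_g.continuous.continuousOn.clm_apply hπc)
  have hFb : ∀ x ∈ N, ‖F x‖ ≤ Cf + Cg * R := fun x hx =>
    (norm_add_le _ _).trans (add_le_add (hCf x)
      ((g x).le_of_opNorm_le_of_le (hCg x) (hR _ (hπU x hx))))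
  -- Off `N` the field `F` may be discontinuous. Peano is applied to `G`; Nagumo confines the
  -- resulting solution to `S`, where `G = F`, so it solves the original equation.
  obtain ⟨G, hG, hGb, V, hV, hSV, hGV⟩ := hFc.exists_continuous_bounded_eqOn hcl hN hSN hFb
  intro x₀ hx₀
  refine ⟨?_, fun T x hx hxT => mem_superlevel_of_hasDerivWithinAt hd hh.eq_superlevel
    hh.fderiv_ne_zero hFS (hx ▸ hx₀) hxT⟩
  obtain ⟨x, hx, hxG⟩ := hG.exists_hasDerivWithinAt_Ici hGb x₀
  have hGS : ∀ p ∈ frontier S, ∃ V ∈ 𝓝 p, ∃ L : ℝ, ∀ x ∈ V, ∀ y ∈ V, y ∈ frontier S →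
      ∃ w, 0 ≤ fderiv ℝ h y w ∧ ‖G x - w‖ ≤ L * ‖x - y‖ := by
    intro p hp
    obtain ⟨V', hV', L, hL⟩ := hFS p hp
    refine ⟨V' ∩ V, Filter.inter_mem hV' (hV.mem_nhds (hSV (hcl.frontier_subset hp))), L, ?_⟩
    intro x hx y hy hyS
    rw [hGV hx.2]
    exact hL x hx.1 y hy.1 hyS
  refine ⟨x, hx, fun t ht => ?_⟩
  have hxS : x t ∈ S := mem_superlevel_of_hasDerivWithinAt hd hh.eq_superlevel
    hh.fderiv_ne_zero hGS (hx ▸ hx₀) (fun s hs => (hxG s hs.1).mono Icc_subset_Ici_self) t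
    ⟨ht, le_rfl⟩
  have := hxG t ht
  rwa [hGV (hSV hxS)] at this

/-- A continuous feedback that keeps trajectories from `S` inside `S` makes `S` control
invariant. -/
theorem KeepsInside.isControlInvariant (hf : Continuous f) (hg : Continuous g)
    (hπ : Continuous π) (hπU : ∀ x, π x ∈ U) (hk : KeepsInside f g π S S) :
    IsControlInvariant f g U S := by
  intro x₀ hx₀
  obtain ⟨⟨x, hx, hxt⟩, hin⟩ := hk x₀ hx₀
  have hxc : ContinuousOn x (Ici 0) := fun t ht => (hxt t ht).continuousWithinAt
  -- The trajectory is controlled only for `t ≥ 0`; freezing it at negative times gives a control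
  -- measurable on all of `ℝ`.
  have hyc : Continuous fun t => x (max t 0) :=
    hxc.comp_continuous (continuous_id.max continuous_const) fun t => le_max_right t 0
  refine ⟨fun t => π (x (max t 0)), x, (hπ.comp hyc).measurable, fun t _ => hπU _, hxc, ?_, ?_⟩
  · intro t ht
    have heq : EqOn (fun s => f (x s) + g (x s) (π (x (max s 0))))
        (fun s => f (x s) + g (x s) (π (x s))) (uIcc 0 t) := fun s hs => by
      rw [uIcc_of_le ht] at hs
      simp only [max_eq_left hs.1]
    have hcont : ContinuousOn (fun s => f (x s) + g (x s) (π (x s))) (uIcc 0 t) := by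
      have hx' : ContinuousOn x (uIcc 0 t) :=
        hxc.mono (by rw [uIcc_of_le ht]; exact Icc_subset_Ici_self)
      exact (hf.comp_continuousOn hx').add
        ((hg.comp_continuousOn hx').clm_apply (hπ.comp_continuousOn hx'))
    refine ⟨(hcont.congr heq).intervalIntegrable, ?_⟩
    rw [intervalIntegral.integral_congr heq,
      intervalIntegral.integral_eq_sub_of_hasDeriv_right_of_le ht
        (hxc.mono Icc_subset_Ici_self) (fun s hs => (hxt s hs.1.le).mono
          fun r hr => hs.1.le.trans (le_of_lt hr)) hcont.intervalIntegrable, hx]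
    abel
  · intro t ht
    exact hin t x hx (fun s hs => (hxt s hs.1).mono Icc_subset_Ici_self) t ⟨ht, le_rfl⟩

/-! ### Feasible inputs and their dependence on the state -/

theorem halfspaceInputs_convex (hU : Convex ℝ U) (x : Vec n) :
    Convex ℝ (halfspaceInputs U a b x) := by
  intro u hu v hv s t hs ht hst
  refine ⟨hU hu.1 hv.1 hs ht hst, ?_⟩
  rw [inner_add_right, real_inner_smul_right, real_inner_smul_right]
  have h1 := mul_le_mul_of_nonneg_left hu.2 hs
  have h2 := mul_le_mul_of_nonneg_left hv.2 ht
  have h3 : b x = s * b x + t * b x := by rw [← add_mul, hst, one_mul]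
  linarith

theorem halfspaceInputs_isCompact (hU : IsCompact U) (x : Vec n) :
    IsCompact (halfspaceInputs U a b x) := by
  have hcl : IsClosed {u : Vec m | b x ≤ inner ℝ (a x) u} :=
    isClosed_le continuous_const (continuous_const.inner continuous_id)
  exact hU.inter_right hcl

open Topology in
/-- If the half-space constraint is not void and its feasible set has an interior point, then
some input satisfies it strictly. -/
theorem exists_strict_of_interior_nonempty {x : Vec n} (hab : ¬ (a x = 0 ∧ b x = 0))
    (hint : (interior (halfspaceInputs U a b x)).Nonempty) :
    ∃ u ∈ U, b x < inner ℝ (a x) u := by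
  obtain ⟨u, hu⟩ := hint
  have huK := interior_subset hu
  refine ⟨u, huK.1, ?_⟩
  by_cases ha : a x = 0
  · have h1 := huK.2
    rw [ha, inner_zero_left] at h1 ⊢
    exact h1.lt_of_ne fun hb => hab ⟨ha, hb⟩
  -- An interior point can be moved against `a x` and stay feasible, so it had slack at least `s *
  -- ‖a x‖ ^ 2`.
  · have hcont : Filter.Tendsto (fun s : ℝ => u - s • a x) (𝓝[>] 0) (𝓝 u) :=
      ((by fun_prop : Continuous fun s : ℝ => u - s • a x).tendsto' 0 u (by simp)).mono_left
        nhdsWithin_le_nhds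
    obtain ⟨s, hs, hs0⟩ := ((hcont.eventually (mem_interior_iff_mem_nhds.1 hu)).and
      eventually_mem_nhdsWithin).exists
    have h1 := hs.2
    rw [inner_sub_right, real_inner_smul_right, real_inner_self_eq_norm_sq] at h1
    have h2 : 0 < s * ‖a x‖ ^ 2 := mul_pos hs0 (by positivity)
    linarith

open Topology in
/-- Near a state at which some input satisfies the half-space constraint strictly, the feasible
sets depend on the state in a Lipschitz way with respect to the Hausdorff distance. -/
theorem exists_halfspaceInputs_norm_sub_le (hUc : Convex ℝ U) (hUb : Bornology.IsBounded U)
    (ha : LocallyLipschitz a) (hb : LocallyLipschitz b) {p : Vec n} {v : Vec m} (hv : v ∈ U)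
    (hpv : b p < inner ℝ (a p) v) :
    ∃ V ∈ 𝓝 p, ∃ L : ℝ, ∀ x ∈ V, ∀ y ∈ V, ∀ u ∈ halfspaceInputs U a b x,
      ∃ w ∈ halfspaceInputs U a b y, ‖u - w‖ ≤ L * ‖x - y‖ := by
  obtain ⟨R, hR⟩ := hUb.exists_norm_le
  have hR0 : 0 ≤ R := (norm_nonneg v).trans (hR v hv)
  obtain ⟨La, hLa0, Va, hVa, hLa⟩ := ha.exists_norm_sub_le p
  obtain ⟨Lb, hLb0, Vb, hVb, hLb⟩ := hb.exists_norm_sub_le p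
  obtain ⟨δ, hδ, hδv⟩ : ∃ δ > 0, δ < inner ℝ (a p) v - b p := exists_between (sub_pos.2 hpv)
  have hcont : Continuous fun x => inner ℝ (a x) v - b x :=
    (ha.continuous.inner continuous_const).sub hb.continuous
  refine ⟨Va ∩ (Vb ∩ {x | δ < inner ℝ (a x) v - b x}), Filter.inter_mem hVa (Filter.inter_mem hVb
    (hcont.continuousAt.eventually (lt_mem_nhds hδv))), (La * R + Lb) / δ * (2 * R), ?_⟩
  rintro x ⟨hxa, hxb, -⟩ y ⟨hya, hyb, hyδ : δ < inner ℝ (a y) v - b y⟩ u hu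
  -- At `y`, the input `u` violates the constraint by at most `η`, while `v` has slack above `δ`.
  -- Weights proportional to `δ` on `u` and `η` on `v` cancel the violation, and move `u` by at most
  -- `η / δ * (2 * R)`.
  set η := (La * R + Lb) * ‖x - y‖ with hη
  have hη0 : 0 ≤ η := by positivity
  have hu' : b y - η ≤ inner ℝ (a y) u := by
    have h1 : inner ℝ (a x) u - inner ℝ (a y) u ≤ La * ‖x - y‖ * R := by
      rw [← inner_sub_left]
      exact (real_inner_le_norm _ _).trans
        (mul_le_mul (hLa x hxa y hya) (hR u hu.1) (norm_nonneg _) (by positivity))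
    have h2 : b y - b x ≤ Lb * ‖x - y‖ := by
      have := (le_abs_self _).trans (hLb y hyb x hxb)
      rwa [norm_sub_rev] at this
    have h3 := hu.2
    rw [hη]
    linarith
  have hpos : 0 < η + δ := by positivity
  have hsum : δ / (η + δ) + η / (η + δ) = 1 := by field_simp; ring
  refine ⟨(δ / (η + δ)) • u + (η / (η + δ)) • v,
    ⟨hUc hu.1 hv (by positivity) (by positivity) hsum, ?_⟩, ?_⟩
  · rw [inner_add_right, real_inner_smul_right, real_inner_smul_right, ← sub_nonneg]
    have e : δ / (η + δ) * inner ℝ (a y) u + η / (η + δ) * inner ℝ (a y) v - b y =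
        (δ * (inner ℝ (a y) u - (b y - η)) + η * (inner ℝ (a y) v - b y - δ)) / (η + δ) := by
      field_simp; ring
    rw [e]
    have h1 := sub_nonneg.2 hu'
    have h2 := (sub_pos.2 hyδ).le
    positivity
  · have e : u - ((δ / (η + δ)) • u + (η / (η + δ)) • v) = (η / (η + δ)) • (u - v) := by
      rw [eq_sub_of_add_eq hsum]; module
    have h1 : ‖u - v‖ ≤ 2 * R := by linarith [norm_sub_le u v, hR u hu.1, hR v hv]
    have h2 : η / (η + δ) ≤ η / δ := by gcongr; linarith
    rw [e, norm_smul, Real.norm_of_nonneg (by positivity)]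
    calc η / (η + δ) * ‖u - v‖ ≤ η / δ * (2 * R) := by gcongr
      _ = _ := by rw [hη]; ring

/-! ### The min-norm program -/

/-- Quadratic growth of the objective of the min-norm program at its solution. -/
theorem IsMinNormInput.norm_sub_sq_le (hU : Convex ℝ U) {r u w : Vec m} {x : Vec n}
    (hu : IsMinNormInput U a b r x u) (hw : w ∈ halfspaceInputs U a b x) :
    ‖w - u‖ ^ 2 ≤ 2 * (‖w - r‖ ^ 2 - ‖u - r‖ ^ 2) := by
  -- The midpoint of `w` and `u` is feasible, so cannot beat `u`; the parallelogram law turns this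
  -- into the estimate.
  have hmid := halfspaceInputs_convex hU x hw hu.1 (by norm_num : (0 : ℝ) ≤ 1 / 2)
    (by norm_num : (0 : ℝ) ≤ 1 / 2) (by norm_num)
  have h1 : ‖u - r‖ ^ 2 ≤ ‖(1 / 2 : ℝ) • w + (1 / 2 : ℝ) • u - r‖ ^ 2 := hu.2 hmid
  have e1 : (1 / 2 : ℝ) • w + (1 / 2 : ℝ) • u - r = (1 / 2 : ℝ) • ((w - r) + (u - r)) := by module
  have e2 : w - u = (w - r) - (u - r) := by abel
  have h2 := parallelogram_law_with_norm ℝ (w - r) (u - r)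
  rw [e1, norm_smul, mul_pow, Real.norm_of_nonneg (by norm_num)] at h1
  rw [e2]
  nlinarith

/-- The min-norm program has exactly one solution where it is feasible. -/
theorem existsUnique_isMinNormInput (hUc : Convex ℝ U) (hUk : IsCompact U) (r : Vec m) {x : Vec n}
    (hne : (halfspaceInputs U a b x).Nonempty) : ∃! u, IsMinNormInput U a b r x u := by
  obtain ⟨u, hu, hmin⟩ := (halfspaceInputs_isCompact (a := a) (b := b) hUk x).exists_isMinOn hne
    (f := fun v => ‖v - r‖ ^ 2) (by fun_prop)
  refine ⟨u, ⟨hu, hmin⟩, fun w hw => ?_⟩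
  have h1 := IsMinNormInput.norm_sub_sq_le hUc ⟨hu, hmin⟩ hw.1
  have h2 : ‖w - r‖ ^ 2 ≤ ‖u - r‖ ^ 2 := hw.2 hu
  have h3 : ‖w - u‖ = 0 := by
    rw [← sq_eq_zero_iff]
    exact le_antisymm (by linarith) (sq_nonneg _)
  exact sub_eq_zero.1 (norm_eq_zero.1 h3)

open Topology in
/-- A min-norm safety filter is continuous at every state at which some input satisfies the
half-space constraint strictly. -/
theorem IsMinNormFilter.continuousAt (hUc : Convex ℝ U) (hUb : Bornology.IsBounded U)
    (ha : LocallyLipschitz a) (hb : LocallyLipschitz b) {πref πsafe : Vec n → Vec m}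
    (hfil : IsMinNormFilter U a b πref πsafe) {p : Vec n} (hr : ContinuousAt πref p) {v : Vec m}
    (hv : v ∈ U) (hpv : b p < inner ℝ (a p) v) : ContinuousAt πsafe p := by
  obtain ⟨V, hV, L, hL⟩ := exists_halfspaceInputs_norm_sub_le hUc hUb ha hb hv hpv
  have hp := hfil p ⟨v, hv, hpv.le⟩
  set D := ‖πsafe p - πref p‖ with hD
  -- Comparing the optima at `x` and `p` transfers an input between feasible sets twice and changes
  -- the reference twice, hence the factors 2. The squared-cost excess is at most `(D + q x) ^ 2 - D
  -- ^ 2`, and quadratic growth produces the square root.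
  let q : Vec n → ℝ := fun x => 2 * (L * ‖x - p‖) + 2 * ‖πref x - πref p‖
  have hsqueeze : Filter.Tendsto (fun x => L * ‖x - p‖ + √(2 * (q x * (2 * D + q x))))
      (𝓝 p) (𝓝 0) := by
    have hc : ContinuousAt (fun x => L * ‖x - p‖ + √(2 * (q x * (2 * D + q x)))) p := by
      have hq : ContinuousAt q p := by fun_prop
      fun_prop
    simpa [ContinuousAt, q] using hc
  rw [ContinuousAt, tendsto_iff_norm_sub_tendsto_zero]
  refine squeeze_zero' (Filter.Eventually.of_forall fun _ => norm_nonneg _) ?_ hsqueeze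
  filter_upwards [hV] with x hx
  obtain ⟨w', hw', hpw'⟩ := hL p (mem_of_mem_nhds hV) x hx _ hp.1
  have hxs := hfil x ⟨w', hw'⟩
  obtain ⟨w, hw, hxw⟩ := hL x hx p (mem_of_mem_nhds hV) _ hxs.1
  rw [norm_sub_rev p x] at hpw'
  have hmin : ‖πsafe x - πref x‖ ≤ ‖w' - πref x‖ := by
    have : ‖πsafe x - πref x‖ ^ 2 ≤ ‖w' - πref x‖ ^ 2 := hxs.2 hw'
    exact (sq_le_sq₀ (norm_nonneg _) (norm_nonneg _)).1 this
  have hwr : ‖w - πref p‖ ≤ D + q x := by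
    have h1 : ‖w - πref p‖ ≤ ‖w - πsafe x‖ + ‖πsafe x - πref x‖ + ‖πref x - πref p‖ := by
      have e : w - πref p = (w - πsafe x) + (πsafe x - πref x) + (πref x - πref p) := by abel
      rw [e]; exact norm_add₃_le
    have h2 : ‖w' - πref x‖ ≤ ‖w' - πsafe p‖ + D + ‖πref p - πref x‖ := by
      have e : w' - πref x = (w' - πsafe p) + (πsafe p - πref p) + (πref p - πref x) := by abel
      rw [e]; exact norm_add₃_le
    rw [norm_sub_rev w (πsafe x)] at h1
    rw [norm_sub_rev w' (πsafe p), norm_sub_rev (πref p)] at h2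
    simp only [q]
    linarith
  have hws : ‖w - πsafe p‖ ≤ √(2 * (q x * (2 * D + q x))) := by
    refine Real.le_sqrt_of_sq_le ((hp.norm_sub_sq_le hUc hw).trans ?_)
    have := pow_le_pow_left₀ (norm_nonneg _) hwr 2
    rw [← hD]
    linarith [this, (by ring : (D + q x) ^ 2 = D ^ 2 + q x * (2 * D + q x))]
  calc ‖πsafe x - πsafe p‖ ≤ ‖πsafe x - w‖ + ‖w - πsafe p‖ := norm_sub_le_norm_sub_add_norm_sub ..
    _ ≤ _ := add_le_add hxw hws

/-! ### Construction of smooth and globally Lipschitz feedbacks -/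

open Topology Manifold in
/-- If on the closed set `S` the half-space constraint can be satisfied strictly, it can be
satisfied on `S` by a smooth feedback. -/
theorem exists_contDiff_feedback (hUc : Convex ℝ U) (hU : U.Nonempty) (ha : Continuous a)
    (hb : Continuous b) (hS : IsClosed S) (hstrict : ∀ x ∈ S, ∃ u ∈ U, b x < inner ℝ (a x) u) :
    ∃ π : Vec n → Vec m, ContDiff ℝ 1 π ∧ (∀ x, π x ∈ U) ∧
      ∀ x ∈ S, b x ≤ inner ℝ (a x) (π x) := by
  -- Admissible sets are convex, so a partition of unity may average local constants: a strictly
  -- feasible input stays feasible nearby, and off the closed set `S` any element of `U` serves.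
  obtain ⟨π, hπ⟩ := exists_contMDiffMap_forall_mem_convex_of_local_const (n := 1) 𝓘(ℝ, Vec n)
    (t := fun x => {u | u ∈ U ∧ (x ∈ S → b x ≤ inner ℝ (a x) u)}) (fun x => by
      by_cases hx : x ∈ S
      · simpa [hx] using! halfspaceInputs_convex (a := a) (b := b) hUc x
      · simpa [hx] using! hUc)
    (fun x => by
      by_cases hx : x ∈ S
      · obtain ⟨u, hu, hxu⟩ := hstrict x hx
        refine ⟨u, ?_⟩
        filter_upwards [hb.continuousAt.eventually_lt
          (ha.inner continuous_const).continuousAt hxu] with y hy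
        exact ⟨hu, fun _ => hy.le⟩
      · obtain ⟨u, hu⟩ := hU
        refine ⟨u, ?_⟩
        filter_upwards [hS.isOpen_compl.mem_nhds hx] with y hy
        exact ⟨hu, fun h => absurd h hy⟩)
  exact ⟨π, π.contMDiff.contDiff, fun x => (hπ x).1, fun x => (hπ x).2⟩

/-- A `C¹` feedback with values in a convex set can be made globally Lipschitz without changing it
on a given bounded set. -/
theorem exists_lipschitz_feedback_eqOn (hUc : Convex ℝ U) (hπ : ContDiff ℝ 1 π)
    (hπU : ∀ x, π x ∈ U) (hS : Bornology.IsBounded S) :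
    ∃ ψ : Vec n → Vec m, (∃ L, LipschitzWith L ψ) ∧ (∀ x, ψ x ∈ U) ∧ EqOn ψ π S := by
  obtain ⟨R, hR⟩ := hS.exists_norm_le
  -- The maximum guards against a negative `R`, possible when `S` is empty. Interpolating between `π
  -- 0` and `π x` with weight `χ x` stays in `U` and differs from a constant by a compactly
  -- supported `C¹` map.
  let χ : ContDiffBump (0 : Vec n) := ⟨max R 0 + 1, max R 0 + 2, by positivity, by linarith⟩
  have hcs : HasCompactSupport fun x => χ x • (π x - π 0) := χ.hasCompactSupport.smul_right
  obtain ⟨L, hL⟩ := ContDiff.lipschitzWith_of_hasCompactSupport (𝕂 := ℝ) hcs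
    (χ.contDiff.smul (hπ.sub contDiff_const)) one_ne_zero
  refine ⟨fun x => π 0 + χ x • (π x - π 0), ⟨0 + L, (LipschitzWith.const (π 0)).add hL⟩,
    fun x => ?_, fun x hx => ?_⟩
  · exact hUc.add_smul_sub_mem (hπU 0) (hπU x) ⟨χ.nonneg, χ.le_one⟩
  · have : χ x = 1 := χ.one_of_mem_closedBall <| by
      rw [mem_closedBall_zero_iff]
      exact (hR x hx).trans ((le_max_left R 0).trans (le_add_of_nonneg_right zero_le_one))
    simp [this]

/-! ### Invariance for the two kinds of feedback -/

/-- A locally Lipschitz feedback that satisfies the half-space constraint on `S` keeps trajectories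
from `S` inside `S`. -/
theorem keepsInside_of_locallyLipschitz (hsys : IsAdmissibleSystem f g U)
    (hh : IsDistanceLike h S) (hS : IsClosed S)
    (hsub : ∀ x ∈ frontier S, halfspaceInputs U a b x ⊆ nagumoInputs f g U h x)
    (hπ : LocallyLipschitz π) (hπU : ∀ x, π x ∈ U) (hπS : ∀ x ∈ S, b x ≤ inner ℝ (a x) (π x)) :
    KeepsInside f g π S S := by
  refine keepsInside_of_lipschitz_close hsys hh hsub isOpen_univ (subset_univ S)
    hπ.continuous.continuousOn (fun x _ => hπU x) fun p _ => ?_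
  obtain ⟨L, -, V, hV, hL⟩ := hπ.exists_norm_sub_le p
  exact ⟨V, hV, L, fun x hx y hy hyS =>
    ⟨π y, ⟨hπU y, hπS y (hS.frontier_subset hyS)⟩, hL x hx y hy⟩⟩

/-- A min-norm safety filter keeps trajectories from `S` inside `S`. -/
theorem IsMinNormFilter.keepsInside (hsys : IsAdmissibleSystem f g U) (hUc : Convex ℝ U)
    (hh : IsDistanceLike h S) (hS : IsClosed S) (ha : LocallyLipschitz a) (hb : LocallyLipschitz b)
    (hsub : ∀ x ∈ frontier S, halfspaceInputs U a b x ⊆ nagumoInputs f g U h x)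
    (hstrict : ∀ x ∈ S, ∃ u ∈ U, b x < inner ℝ (a x) u) {πref πsafe : Vec n → Vec m}
    (hr : Continuous πref) (hfil : IsMinNormFilter U a b πref πsafe) :
    KeepsInside f g πsafe S S := by
  have hUb := hsys.compact_U.isBounded
  -- The filter is arbitrary where the program is infeasible; strict feasibility provides an open
  -- neighbourhood of `S` on which it is feasible and continuous.
  have hN : IsOpen {x | ∃ u ∈ U, b x < inner ℝ (a x) u} := by
    have : {x | ∃ u ∈ U, b x < inner ℝ (a x) u} = ⋃ u ∈ U, {x | b x < inner ℝ (a x) u} := by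
      ext; simp
    rw [this]
    exact isOpen_biUnion fun u _ =>
      isOpen_lt hb.continuous (ha.continuous.inner continuous_const)
  have hmem : ∀ x ∈ {x | ∃ u ∈ U, b x < inner ℝ (a x) u},
      πsafe x ∈ halfspaceInputs U a b x := fun x ⟨u, hu, hxu⟩ => (hfil x ⟨u, hu, hxu.le⟩).1
  refine keepsInside_of_lipschitz_close hsys hh hsub hN hstrict (fun x ⟨u, hu, hxu⟩ =>
    (hfil.continuousAt hUc hUb ha hb hr.continuousAt hu hxu).continuousWithinAt)
    (fun x hx => (hmem x hx).1) fun p hp => ?_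
  obtain ⟨v, hv, hpv⟩ := hstrict p (hS.frontier_subset hp)
  obtain ⟨V, hV, L, hL⟩ := exists_halfspaceInputs_norm_sub_le hUc hUb ha hb hv hpv
  exact ⟨V ∩ {x | ∃ u ∈ U, b x < inner ℝ (a x) u},
    Filter.inter_mem hV (hN.mem_nhds ⟨v, hv, hpv⟩), L,
    fun x hx y hy _ => hL x hx.1 y hy.1 _ (hmem x hx.2)⟩

end SafetyFilter

theorem theorem1 {n m : ℕ}
    (f : SafetyFilter.Vec n → SafetyFilter.Vec n)
    (g : SafetyFilter.Vec n → (SafetyFilter.Vec m →L[ℝ] SafetyFilter.Vec n))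
    (U : Set (SafetyFilter.Vec m)) (S : Set (SafetyFilter.Vec n))
    (h : SafetyFilter.Vec n → ℝ)
    (a : SafetyFilter.Vec n → SafetyFilter.Vec m) (b : SafetyFilter.Vec n → ℝ)
    (hsys : SafetyFilter.IsAdmissibleSystem f g U)
    (hU : SafetyFilter.IsPolytope U)
    (hh : SafetyFilter.IsDistanceLike h S)
    (ha : LocallyLipschitz a) (hb : LocallyLipschitz b)
    (hab : ∀ x ∈ S, ¬ (a x = 0 ∧ b x = 0))
    (hint : ∀ x ∈ S, (interior (SafetyFilter.halfspaceInputs U a b x)).Nonempty)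
    (hsub : ∀ x ∈ frontier S,
      SafetyFilter.halfspaceInputs U a b x ⊆ SafetyFilter.nagumoInputs f g U h x) :
    SafetyFilter.IsDiscriminatingHyperplane f g U S a b ∧
    (∀ π : SafetyFilter.Vec n → SafetyFilter.Vec m, LocallyLipschitz π → (∀ x, π x ∈ U) →
      (∀ x ∈ S, b x ≤ inner ℝ (a x) (π x)) → SafetyFilter.KeepsInside f g π S S) ∧
    (∀ πref : SafetyFilter.Vec n → SafetyFilter.Vec m,
      LocallyLipschitz πref → (∀ x, πref x ∈ U) →
      (∀ x ∈ S, ∃! u, SafetyFilter.IsMinNormInput U a b (πref x) x u) ∧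
      ∀ πsafe : SafetyFilter.Vec n → SafetyFilter.Vec m,
        SafetyFilter.IsMinNormFilter U a b πref πsafe →
        SafetyFilter.KeepsInside f g πsafe S S) := by

  have hUk := hsys.compact_U
  obtain ⟨hUc, hUne⟩ : Convex ℝ U ∧ U.Nonempty := by
    obtain ⟨V, hV, rfl⟩ := hU
    exact ⟨convex_convexHull ℝ _, hV.to_set.convexHull⟩
  have hS : IsClosed S :=
    hh.eq_superlevel ▸ isClosed_le continuous_const hh.contDiff.continuous
  have hstrict : ∀ x ∈ S, ∃ u ∈ U, b x < inner ℝ (a x) u := fun x hx =>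
    SafetyFilter.exists_strict_of_interior_nonempty (hab x hx) (hint x hx)
  have hkeep : ∀ π : SafetyFilter.Vec n → SafetyFilter.Vec m, LocallyLipschitz π →
      (∀ x, π x ∈ U) → (∀ x ∈ S, b x ≤ inner ℝ (a x) (π x)) →
      SafetyFilter.KeepsInside f g π S S := fun π =>
    SafetyFilter.keepsInside_of_locallyLipschitz hsys hh hS hsub
  obtain ⟨π, hπ, hπU, hπS⟩ := SafetyFilter.exists_contDiff_feedback hUc hUne ha.continuous
    hb.continuous hS hstrict
  refine ⟨⟨(hkeep π hπ.locallyLipschitz hπU hπS).isControlInvariant hsys.lipschitz_f.continuous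
    hsys.lipschitz_g.continuous hπ.continuous hπU, fun X hX => ⟨hX, ?_⟩⟩, hkeep,
    fun πref hr _ => ⟨fun x hx => ?_, fun πsafe hfil => hfil.keepsInside hsys hUc hh hS ha hb hsub
      hstrict hr.continuous⟩⟩
  · obtain ⟨ψ, hψ, hψL, hψU, hψS⟩ : ∃ ψ : SafetyFilter.Vec n → SafetyFilter.Vec m,
        LocallyLipschitz ψ ∧ (IsCompact S → ∃ L, LipschitzWith L ψ) ∧ (∀ x, ψ x ∈ U) ∧
        ∀ x ∈ S, b x ≤ inner ℝ (a x) (ψ x) := by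
      by_cases hSk : IsCompact S
      · obtain ⟨ψ, ⟨L, hL⟩, hψU, hψS⟩ :=
          SafetyFilter.exists_lipschitz_feedback_eqOn hUc hπ hπU hSk.isBounded
        exact ⟨ψ, hL.locallyLipschitz, fun _ => ⟨L, hL⟩, hψU, fun x hx => hψS hx ▸ hπS x hx⟩
      · exact ⟨π, hπ.locallyLipschitz, fun h => absurd h hSk, hπU, hπS⟩
    refine ⟨ψ, hψ, hψL, hψU, fun x hx => sub_nonneg.2 (hψS x hx), fun x₀ hx₀ => ?_⟩
    obtain ⟨hex, hin⟩ := hkeep ψ hψ hψU hψS x₀ hx₀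
    exact ⟨hex, fun T x hx hxT t ht => hX (hin T x hx hxT t ht)⟩
  · obtain ⟨u, hu, hxu⟩ := hstrict x hx
    exact SafetyFilter.existsUnique_isMinNormInput hUc hUk (πref x) ⟨u, hu, hxu.le⟩
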